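/- For a well quasi-order $A$ let $\mathbf w(A)$ denote its width, i.e. the rank $\sup_s (r(s)+1)$ of the forest of non-empty finite sequences of pairwise incomparable elements of $A$, in which the children of $s$ are the sequences in the forest that extend $s$ by one element, and where $r(s)=\sup\{r(t)+1 : t \text{ a child of } s\}$. Let $\oplus$ and $\otimes$ be the natural (Hessenberg) sum and product of ordinals. **Theorem (Cartesian product of infinite ordinals).** Let $n\ge 1$, let $\alpha_1,\dots,\alpha_n$ be infinite ordinals, and let $X=\alpha_1\times\dots\times\alpha_n$ be their cartesian product with the componentwise order. Write each $\alpha_i$ in normal form in three ways: $$\alpha_i=\sum_{j<l_i}\omega^{\alpha_{i,j}}=\sum_{j<l'_i}\omega^{\alpha'_{i,j}}\cdot a_{i,j}=\omega^{\alpha'_i}\cdot a_i+\sigma_i,$$ where $\alpha_{i,0}\ge\dots\ge\alpha_{i,l_i-1}$ (without multiplicities); $\alpha'_{i,0}>\dots>\alpha'_{i,l'_i-1}$ and the $a_{i,j}$ are positive integers (developed); $a_i$ is a positive integer and $\sigma_i<\omega^{\alpha'_i}$ (short). Set: - $Gr(X)$ is the set of $s\in l_1\times\dots\times l_n$ such that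 $s(k)=0$ for some $k$, and $X_s\subseteq X$ is the set of the $x\in X$ with $\sum_{j<s(i)}\omega^{\alpha_{i,j}}\le x_i<\sum_{j\le s(i)}\omega^{\alpha_{i,j}}$ for all $i$; - $Gr'(X)$ is the set of $t\in l'_1\times\dots\times l'_n$ such that $t(k)=0$ for some $k$, and $X_t=\omega^{\alpha'_{1,t(1)}}\times\dots\times\omega^{\alpha'_{n,t(n)}}$; - for $I\subseteq[1,n]$, $X_I=\prod_{i\in I}\omega^{\alpha'_i}\times\prod_{i\notin I}\sigma_i$ (cartesian product with the componentwise order; it is empty, of width $0$, if $\sigma_i=0$ for some $i\notin I$). Then $$\begin{aligned}\mathbf w(X)&=\bigoplus_{s\in Gr(X)}\mathbf w(X_s)\\&=\bigoplus_{t\in Gr'(X)}\mathbf w(X_t)\otimes\Big[\Big(\prod_{t(i)=0}a_{i,0}-\prod_{t(i)=0}(a_{i,0}-1)\Big)\cdot\prod_{t(i)>0}a_{i,t(i)}\Big]\\&=\bigoplus_{\emptyset\ne I\subseteq[1,n]}\mathbf w(X_I)\otimes\Big(\prod_{i\in I}a_i-\prod_{i\in I}(a_i-1)\Big).\end{aligned}$$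 -/

import Mathlib

universe u v

open Ordinal

namespace WqoWidth

/-! ### The width of a well quasi-order -/

instance subtypeWellQuasiOrderedLE {A : Type u} [Preorder A] [WellQuasiOrderedLE A]
    (p : A → Prop) : WellQuasiOrderedLE (Subtype p) where
  wqo f := wellQuasiOrdered_le (fun n => (f n : A))

/-- `x` and `y` are incomparable. -/
def Incomp {A : Type u} [Preorder A] (x y : A) : Prop := ¬ x ≤ y ∧ ¬ y ≤ x

/-- The nodes of the forest `Inco(A)`: the non-empty finite sequences of pairwise incomparable
elements of `A`. -/
def Inco (A : Type u) [Preorder A] : Type u :=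
  {s : List A // s ≠ [] ∧ s.Pairwise Incomp}

/-- `t` is a child of `s`: the sequence `t` is `s` followed by one more element. -/
def Inco.IsChild {A : Type u} [Preorder A] (t s : Inco A) : Prop :=
  ∃ y : A, t.1 = s.1 ++ [y]

theorem Inco.wellFounded_isChild (A : Type u) [Preorder A] [WellQuasiOrderedLE A] :
    WellFounded (Inco.IsChild (A := A)) := by
  rw [wellFounded_iff_isEmpty_descending_chain]
  refine ⟨fun ⟨f, hf⟩ => ?_⟩
  choose y hy using hf
  have key : ∀ m k, y m ∈ (f (m + 1 + k)).1 := by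
    intro m k
    induction k with
    | zero => simp [hy]
    | succ k ih => rw [← Nat.add_assoc, hy]; exact List.mem_append_left _ ih
  obtain ⟨m, k, hmk, hle⟩ := wellQuasiOrdered_le y
  obtain ⟨d, rfl⟩ := Nat.exists_eq_add_of_lt hmk
  have hp := (f (m + d + 1 + 1)).2.2
  rw [hy, List.pairwise_append] at hp
  refine (hp.2.2 (y m) ?_ (y (m + d + 1)) (by simp)).1 hle
  have := key m d
  rwa [show m + 1 + d = m + d + 1 by omega] at this

instance (A : Type u) [Preorder A] [WellQuasiOrderedLE A] :
    IsWellFounded (Inco A) Inco.IsChild :=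
  ⟨Inco.wellFounded_isChild A⟩

/-- The width `w(A)` of a well quasi-order `A`: the rank `sup (r(s) + 1)` of the forest `Inco(A)`,
where `r(s)` is the supremum of `r(t) + 1` over the children `t` of `s`. -/
noncomputable def width (A : Type u) [Preorder A] [WellQuasiOrderedLE A] : Ordinal.{u} :=
  ⨆ s : Inco A, Order.succ (IsWellFounded.rank Inco.IsChild s)

/-! ### Natural (Hessenberg) operations on ordinals -/

/-- The multiplicities of the Cantor normal form of `o`: the value at `e` is the (finite)
coefficient of `ω ^ e`. -/
noncomputable def multiplicities (o : Ordinal.{u}) : Ordinal.{u} →₀ ℕ :=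
  (CNF.coeff ω o).mapRange (fun c => Cardinal.toNat c.card) (by simp)

/-- The ordinal whose Cantor normal form has the given multiplicities. -/
noncomputable def ofMultiplicities (f : Ordinal.{u} →₀ ℕ) : Ordinal.{u} :=
  CNF.eval ω (f.mapRange (fun m : ℕ => (m : Ordinal.{u})) Nat.cast_zero)

/-- The natural sum `a ⊕ b`: Cantor normal forms are added coefficientwise. -/
noncomputable def natAdd (a b : Ordinal.{u}) : Ordinal.{u} :=
  ofMultiplicities (multiplicities a + multiplicities b)

/-- The natural sum of a finite family of ordinals. -/
noncomputable def natSum {ι : Type v} (s : Finset ι) (f : ι → Ordinal.{u}) : Ordinal.{u} :=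
  ofMultiplicities (∑ i ∈ s, multiplicities (f i))

/-- The natural product `a ⊗ b`: Cantor normal forms are multiplied like polynomials in `ω`, with
`ω ^ e ⊗ ω ^ f = ω ^ (e ⊕ f)`. -/
noncomputable def natMul (a b : Ordinal.{u}) : Ordinal.{u} :=
  ofMultiplicities ((multiplicities a).sum fun e m =>
    (multiplicities b).sum fun f k => Finsupp.single (natAdd e f) (m * k))

/-! ### Three ways to write an ordinal in Cantor normal form -/

/-- The ordered sum `∑_{j < k} ω ^ e_j`, that is, the sum of the first `k` of the `l` terms. -/
noncomputable def partialSum {l : ℕ} (e : Fin l → Ordinal.{u}) (k : ℕ) : Ordinal.{u} :=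
  ((List.ofFn fun j => ω ^ e j).take k).sum

/-- `o = ∑_{j < l} ω ^ e_j` with `e_0 ≥ ... ≥ e_{l-1}`: normal form without multiplicities. -/
def IsPlainNF (o : Ordinal.{u}) {l : ℕ} (e : Fin l → Ordinal.{u}) : Prop :=
  Antitone e ∧ o = partialSum e l

/-- `o = ∑_{j < l} ω ^ e_j * a_j` with `e_0 > ... > e_{l-1}` and all `a_j` positive integers:
developed normal form. -/
def IsDevelopedNF (o : Ordinal.{u}) {l : ℕ} (e : Fin l → Ordinal.{u}) (a : Fin l → ℕ) : Prop :=
  StrictAnti e ∧ (∀ j, 0 < a j) ∧ o = (List.ofFn fun j => ω ^ e j * (a j : Ordinal.{u})).sum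

/-- `o = ω ^ e * a + σ` with `a` a positive integer and `σ < ω ^ e`: short normal form. -/
def IsShortNF (o e : Ordinal.{u}) (a : ℕ) (σ : Ordinal.{u}) : Prop :=
  0 < a ∧ σ < ω ^ e ∧ o = ω ^ e * (a : Ordinal.{u}) + σ

/-! ### Products of ordinals and their slices -/

/-- The cartesian product `β_1 × ... × β_n` with the componentwise order, each ordinal being the
well-order of its predecessors. -/
abbrev OrdProd {n : ℕ} (β : Fin n → Ordinal.{u}) : Type (u + 1) :=
  ∀ i, Set.Iio (β i)

/-- The slice `X_s` of the product `X` of the ordinals `α_i`, for `s ∈ l_1 × ... × l_n`: the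
elements whose `i`-th component `δ` satisfies `∑_{j < s(i)} ω ^ e_{i,j} ≤ δ < ∑_{j ≤ s(i)} ω ^ e_{i,j}`
for all `i`. -/
def slice {n : ℕ} (α : Fin n → Ordinal.{u}) {l : Fin n → ℕ} (e : ∀ i, Fin (l i) → Ordinal.{u})
    (s : ∀ i, Fin (l i)) : Set (OrdProd α) :=
  {x | ∀ i, partialSum (e i) (s i) ≤ (x i : Ordinal.{u}) ∧
    (x i : Ordinal.{u}) < partialSum (e i) (s i + 1)}

/-- The set of grounded `s ∈ l_1 × ... × l_n`: those with a vanishing component. -/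
def grounded {n : ℕ} (l : Fin n → ℕ) : Finset (∀ i, Fin (l i)) :=
  Finset.univ.filter fun s => ∃ k, (s k : ℕ) = 0

end WqoWidth

universe w

namespace WqoWidth

/-! ### Multiplicities -/

/-! The width obeys a game-like recursion: it is the supremum over `x` of the successor of the width
of the part incomparable to `x` (`width_residual_lt`, `width_le_of_forall`). Cut each `α i` into the
intervals of its plain normal form; this cuts the product into blocks.

Upper bound: the width of a set is at most the natural sum of the widths of the pieces of a cover
(`width_le_natSum`). The diagonals `t + c * (1, ..., 1)` with `t` grounded cover the product, and a
diagonal is an ordered sum of ever narrower blocks, so it is no wider than its first one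
(`width_diagonal_le`).

Lower bound: the blocks are played one after the other. By `add_width_le` it suffices that finitely
many moves in the other grounded blocks leave a full copy of the last block
(`width_block_le_residual`); this needs infinite `α i`, so that the first intervals have limit
length. Each block has width a power of `ω` (`exists_width_box_eq_opow`), hence playing a widest
block last turns the ordinary sum into a natural sum.

The width of a block depends only on its exponents, so the other two formulas follow by collecting
equal terms and counting. In the short form, `X_I` is itself a union of grounded blocks, to which
`width_iUnion_block` applies. -/

theorem coeff_eq_natCast_multiplicities (o e : Ordinal.{u}) :
    CNF.coeff ω o e = (multiplicities o e : Ordinal.{u}) := by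
  have h : CNF.coeff ω o e < ω := by
    by_cases h : e ∈ (CNF ω o).map Prod.fst
    · obtain ⟨⟨e', c⟩, hc, rfl⟩ := List.mem_map.1 h
      rw [CNF.coeff_of_mem_CNF hc]
      exact CNF.snd_lt one_lt_omega0 hc
    · rw [CNF.coeff_of_notMem_CNF h]
      exact omega0_pos
  obtain ⟨m, hm⟩ := lt_omega0.1 h
  simp [multiplicities, hm]

theorem mapRange_multiplicities (o : Ordinal.{u}) :
    (multiplicities o).mapRange (fun m : ℕ => (m : Ordinal.{u})) Nat.cast_zero = CNF.coeff ω o := by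
  ext1 e
  simp [coeff_eq_natCast_multiplicities]

@[simp]
theorem ofMultiplicities_multiplicities (o : Ordinal.{u}) :
    ofMultiplicities (multiplicities o) = o := by
  rw [ofMultiplicities, mapRange_multiplicities, CNF.eval_coeff]

@[simp]
theorem multiplicities_ofMultiplicities (f : Ordinal.{u} →₀ ℕ) :
    multiplicities (ofMultiplicities f) = f := by
  ext e
  apply Nat.cast_injective (R := Ordinal.{u})
  rw [← coeff_eq_natCast_multiplicities, ofMultiplicities, CNF.coeff_eval one_lt_omega0]
  · simp
  · simp [natCast_lt_omega0]

theorem multiplicities_injective : Function.Injective multiplicities.{u} :=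
  Function.LeftInverse.injective ofMultiplicities_multiplicities

@[simp]
theorem ofMultiplicities_zero : ofMultiplicities.{u} 0 = 0 := by
  simp [ofMultiplicities]

@[simp]
theorem multiplicities_zero : multiplicities.{u} 0 = 0 := by
  simp [multiplicities]

theorem ofMultiplicities_single_add {e : Ordinal.{u}} {m : ℕ} {f : Ordinal.{u} →₀ ℕ}
    (h : ∀ e' ∈ f.support, e' ≤ e) :
    ofMultiplicities (.single e m + f) = ω ^ e * m + ofMultiplicities f := by
  rw [ofMultiplicities, Finsupp.mapRange_add (by simp), Finsupp.mapRange_single,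
    CNF.eval_single_add]
  · rfl
  · intro e' he'
    exact h e' (by simpa using he')

theorem ofMultiplicities_single (e : Ordinal.{u}) (m : ℕ) :
    ofMultiplicities (.single e m) = ω ^ e * m := by
  simpa using ofMultiplicities_single_add (e := e) (m := m) (f := 0)

theorem multiplicities_opow_mul (e : Ordinal.{u}) (m : ℕ) :
    multiplicities (ω ^ e * m) = .single e m := by
  rw [← ofMultiplicities_single, multiplicities_ofMultiplicities]

theorem multiplicities_opow (e : Ordinal.{u}) : multiplicities (ω ^ e) = .single e 1 := by
  simpa using multiplicities_opow_mul e 1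

theorem multiplicities_natCast (m : ℕ) : multiplicities (m : Ordinal.{u}) = .single 0 m := by
  simpa using multiplicities_opow_mul 0 m

theorem ofMultiplicities_lt_opow {e : Ordinal.{u}} {f : Ordinal.{u} →₀ ℕ} :
    ofMultiplicities f < ω ^ e ↔ ∀ e' ∈ f.support, e' < e := by
  constructor
  · intro h e' he'
    by_contra! hle
    have h1 := CNF.coeff_eq_zero_of_lt (h.trans_le (opow_le_opow_right omega0_pos hle))
    rw [coeff_eq_natCast_multiplicities, multiplicities_ofMultiplicities] at h1
    simp_all
  · intro h
    refine CNF.eval_lt (fun e' => by simp [natCast_lt_omega0]) fun e' he' => h e' ?_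
    simpa using he'

theorem lt_opow_iff {e o : Ordinal.{u}} : o < ω ^ e ↔ ∀ e' ∈ (multiplicities o).support, e' < e := by
  rw [← ofMultiplicities_lt_opow, ofMultiplicities_multiplicities]

theorem multiplicities_opow_mul_add {e r : Ordinal.{u}} {m : ℕ} (hr : r < ω ^ Order.succ e) :
    multiplicities (ω ^ e * m + r) = .single e m + multiplicities r := by
  have := ofMultiplicities_single_add (e := e) (m := m) (f := multiplicities r)
    fun e' he' => Order.lt_succ_iff.1 (lt_opow_iff.1 hr e' he')
  rw [ofMultiplicities_multiplicities] at this
  rw [← this, multiplicities_ofMultiplicities]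

/-- Induction on the number of exponents of `f` above `e`: common leading terms cancel, and once
none is left the gap at `e` outweighs everything below `ω ^ e`. -/
theorem ofMultiplicities_lt_of_lex {f g : Ordinal.{u} →₀ ℕ} {e : Ordinal.{u}} (he : f e < g e)
    (h : ∀ e', e < e' → f e' = g e') : ofMultiplicities f < ofMultiplicities g := by
  classical
  induction hk : (f.support.filter (e < ·)).card generalizing f g with
  | zero =>
    have hf : ∀ e' ∈ f.support, e' ≤ e := by
      intro e' he'
      by_contra! hlt
      have := Finset.card_eq_zero.1 hk
      simpa using this.subset (Finset.mem_filter.2 ⟨he', hlt⟩)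
    have hg : ∀ e' ∈ g.support, e' ≤ e := by
      intro e' he'
      by_contra! hlt
      have := hf e' (by rw [Finsupp.mem_support_iff] at he' ⊢; rwa [h e' hlt])
      exact this.not_gt hlt
    rw [← Finsupp.single_add_erase e f, ← Finsupp.single_add_erase e g,
      ofMultiplicities_single_add, ofMultiplicities_single_add]
    · calc ω ^ e * (f e : Ordinal.{u}) + ofMultiplicities (f.erase e)
          < ω ^ e * (f e : Ordinal.{u}) + ω ^ e := by
            gcongr
            rw [ofMultiplicities_lt_opow]
            intro e' he'
            rw [Finsupp.support_erase, Finset.mem_erase] at he'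
            exact lt_of_le_of_ne (hf e' he'.2) he'.1
        _ = ω ^ e * ((f e + 1 : ℕ) : Ordinal.{u}) := by push_cast; rw [mul_add_one]
        _ ≤ ω ^ e * (g e : Ordinal.{u}) := by gcongr; exact he
        _ ≤ _ := le_self_add
    · intro e' he'
      exact hg e' (Finset.mem_of_mem_erase (by simpa using he'))
    · intro e' he'
      exact hf e' (Finset.mem_of_mem_erase (by simpa using he'))
  | succ k ih =>
    have hne : f.support.Nonempty := by
      rw [Finset.nonempty_iff_ne_empty]
      rintro h0
      simp [h0] at hk
    obtain ⟨m, hm, hmax⟩ := Finset.exists_max_image f.support id hne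
    simp only [id] at hmax
    have hem : e < m := by
      obtain ⟨x, hx⟩ := Finset.card_pos.1 (k.succ_pos.trans_eq hk.symm)
      rw [Finset.mem_filter] at hx
      exact hx.2.trans_le (hmax x hx.1)
    have hgmax : ∀ e' ∈ g.support, e' ≤ m := by
      intro e' he'
      by_contra! hlt
      refine (hmax e' ?_).not_gt hlt
      rw [Finsupp.mem_support_iff] at he' ⊢
      rwa [h e' (hem.trans hlt)]
    rw [← Finsupp.single_add_erase m f, ← Finsupp.single_add_erase m g,
      ofMultiplicities_single_add, ofMultiplicities_single_add, h m hem]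
    · gcongr
      apply ih
      · rwa [Finsupp.erase_ne hem.ne, Finsupp.erase_ne hem.ne]
      · intro e' he'
        simp only [Finsupp.erase_apply]
        split_ifs
        · rfl
        · exact h e' he'
      · rw [Finsupp.support_erase, Finset.filter_erase, Finset.card_erase_of_mem, hk]
        · rfl
        · exact Finset.mem_filter.2 ⟨hm, hem⟩
    · intro e' he'
      exact hgmax e' (Finset.mem_of_mem_erase (by simpa using he'))
    · intro e' he'
      exact hmax e' (Finset.mem_of_mem_erase (by simpa using he'))

theorem ofMultiplicities_lt_iff {f g : Ordinal.{u} →₀ ℕ} :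
    ofMultiplicities f < ofMultiplicities g ↔ ∃ e, f e < g e ∧ ∀ e', e < e' → f e' = g e' := by
  classical
  refine ⟨fun h => ?_, fun ⟨e, he, h⟩ => ofMultiplicities_lt_of_lex he h⟩
  have hne : (Finsupp.neLocus f g).Nonempty := by
    rw [Finsupp.nonempty_neLocus_iff]
    rintro rfl
    exact h.false
  obtain ⟨m, hm, hmax⟩ := Finset.exists_max_image _ id hne
  have hEq : ∀ e', m < e' → f e' = g e' := by
    intro e' he'
    by_contra hcon
    exact (hmax e' (Finsupp.mem_neLocus.2 hcon)).not_gt he'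
  rcases lt_or_gt_of_ne (Finsupp.mem_neLocus.1 hm) with hlt | hlt
  · exact ⟨m, hlt, hEq⟩
  · exact absurd (ofMultiplicities_lt_of_lex hlt fun e' he' => (hEq e' he').symm) h.not_gt

/-! ### Natural sums -/

theorem natAdd_comm (a b : Ordinal.{u}) : natAdd a b = natAdd b a := by
  rw [natAdd, natAdd, add_comm]

@[simp]
theorem natAdd_zero (a : Ordinal.{u}) : natAdd a 0 = a := by
  simp [natAdd]

/-- The lexicographic criterion is invariant under adding the same multiplicities to both sides. -/
theorem natAdd_lt_natAdd_left {a b : Ordinal.{u}} (h : a < b) (c : Ordinal.{u}) :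
    natAdd c a < natAdd c b := by
  rw [← ofMultiplicities_multiplicities a, ← ofMultiplicities_multiplicities b,
    ofMultiplicities_lt_iff] at h
  rw [natAdd, natAdd, ofMultiplicities_lt_iff]
  simpa using h

theorem natAdd_le_natAdd_left {a b : Ordinal.{u}} (h : a ≤ b) (c : Ordinal.{u}) :
    natAdd c a ≤ natAdd c b := by
  rcases h.eq_or_lt with rfl | h
  · rfl
  · exact (natAdd_lt_natAdd_left h c).le

theorem natAdd_lt_natAdd_right {a b : Ordinal.{u}} (h : a < b) (c : Ordinal.{u}) :
    natAdd a c < natAdd b c := by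
  rw [natAdd_comm a, natAdd_comm b]
  exact natAdd_lt_natAdd_left h c

theorem natAdd_le_natAdd_right {a b : Ordinal.{u}} (h : a ≤ b) (c : Ordinal.{u}) :
    natAdd a c ≤ natAdd b c := by
  rw [natAdd_comm a, natAdd_comm b]
  exact natAdd_le_natAdd_left h c

theorem opow_add_eq_natAdd {e o : Ordinal.{u}} (ho : o < ω ^ Order.succ e) :
    ω ^ e + o = natAdd (ω ^ e) o := by
  apply multiplicities_injective
  rw [natAdd, multiplicities_ofMultiplicities, multiplicities_opow]
  simpa using multiplicities_opow_mul_add (m := 1) ho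

@[simp]
theorem natSum_empty {ι : Type v} (f : ι → Ordinal.{u}) : natSum ∅ f = 0 := by
  simp [natSum]

theorem multiplicities_natSum {ι : Type v} (s : Finset ι) (f : ι → Ordinal.{u}) :
    multiplicities (natSum s f) = ∑ i ∈ s, multiplicities (f i) := by
  rw [natSum, multiplicities_ofMultiplicities]

theorem natSum_insert {ι : Type v} [DecidableEq ι] {s : Finset ι} {i : ι} (hi : i ∉ s)
    (f : ι → Ordinal.{u}) : natSum (insert i s) f = natAdd (f i) (natSum s f) := by
  rw [natAdd, multiplicities_natSum, natSum, Finset.sum_insert hi]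

theorem natSum_le_natSum {ι : Type v} {s : Finset ι} {f g : ι → Ordinal.{u}}
    (h : ∀ i ∈ s, f i ≤ g i) : natSum s f ≤ natSum s g := by
  classical
  induction s using Finset.induction_on with
  | empty => simp
  | insert i s hi ih =>
    rw [natSum_insert hi, natSum_insert hi]
    exact (natAdd_le_natAdd_right (h i (Finset.mem_insert_self ..)) _).trans
      (natAdd_le_natAdd_left (ih fun j hj => h j (Finset.mem_insert_of_mem hj)) _)

theorem natSum_lt_natSum {ι : Type v} {s : Finset ι} {f g : ι → Ordinal.{u}}
    (h : ∀ i ∈ s, f i ≤ g i) {j : ι} (hj : j ∈ s) (hlt : f j < g j) :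
    natSum s f < natSum s g := by
  classical
  rw [← Finset.insert_erase hj, natSum_insert (Finset.notMem_erase _ _),
    natSum_insert (Finset.notMem_erase _ _)]
  exact (natAdd_lt_natAdd_right hlt _).trans_le (natAdd_le_natAdd_left
    (natSum_le_natSum fun i hi => h i (Finset.mem_of_mem_erase hi)) _)

theorem natSum_lt_opow {ι : Type v} {s : Finset ι} {f : ι → Ordinal.{u}} {e : Ordinal.{u}}
    (h : ∀ i ∈ s, f i < ω ^ e) : natSum s f < ω ^ e := by
  classical
  rw [lt_opow_iff, multiplicities_natSum]
  intro e' he'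
  obtain ⟨i, hi, hie⟩ := Finset.mem_biUnion.1 (Finsupp.support_finsetSum he')
  exact lt_opow_iff.1 (h i hi) e' hie

theorem multiplicities_natMul_natCast (o : Ordinal.{u}) (c : ℕ) :
    multiplicities (natMul o c) = c • multiplicities o := by
  rw [natMul, multiplicities_ofMultiplicities, multiplicities_natCast]
  conv_rhs => rw [← Finsupp.sum_single (multiplicities o), Finsupp.smul_sum]
  refine Finsupp.sum_congr fun e _ => ?_
  rw [Finsupp.sum_single_index (by simp), natAdd_zero, Finsupp.smul_single, mul_comm]
  rfl

section

/-! ### Recursive description of the width -/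

/-- The node `b, φ a₁, ..., φ aₖ` obtained from the node `a₁, ..., aₖ`. -/
def Inco.cons {A B : Type u} [Preorder A] [Preorder B] (φ : A → B) (b : B)
    (hφ : ∀ a a', Incomp (φ a) (φ a') ↔ Incomp a a') (hb : ∀ a, Incomp b (φ a)) (t : Inco A) :
    Inco B :=
  ⟨b :: t.1.map φ, List.cons_ne_nil _ _, List.pairwise_cons.2 ⟨by simpa using fun a _ => hb a,
    List.pairwise_map.2 (t.2.2.imp fun {a a'} h => (hφ a a').2 h)⟩⟩

/-- As `φ` reaches everything incomparable to `b`, the nodes strictly below the root `b` form a copy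
of `Inco A`. -/
theorem Inco.rank_cons {A B : Type u} [Preorder A] [Preorder B] [WellQuasiOrderedLE A]
    [WellQuasiOrderedLE B] (φ : A → B) (b : B)
    (hφ : ∀ a a', Incomp (φ a) (φ a') ↔ Incomp a a') (hb : ∀ a, Incomp b (φ a))
    (hrange : ∀ y, Incomp b y → ∃ a, φ a = y) (t : Inco A) :
    IsWellFounded.rank Inco.IsChild (Inco.cons φ b hφ hb t) =
      IsWellFounded.rank Inco.IsChild t := by
  induction t using IsWellFounded.induction (Inco.IsChild (A := A)) with
  | _ t ih =>
  apply le_antisymm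
  · rw [IsWellFounded.rank_eq]
    refine Ordinal.iSup_le fun ⟨s, y, hs⟩ => ?_
    have hp := s.2.2
    rw [hs, Inco.cons, List.pairwise_append] at hp
    obtain ⟨a, rfl⟩ := hrange y (hp.2.2 b (by simp) y (by simp))
    have ht : (t.1 ++ [a]).Pairwise Incomp := by
      refine List.pairwise_append.2 ⟨t.2.2, by simp, fun c hc d hd => ?_⟩
      obtain rfl : d = a := by simpa using hd
      exact (hφ c d).1 (hp.2.2 (φ c) (by simpa using Or.inr ⟨c, hc, rfl⟩) (φ d) (by simp))
    let t' : Inco A := ⟨t.1 ++ [a], by simp, ht⟩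
    have hs' : s = Inco.cons φ b hφ hb t' := Subtype.ext (by simp [hs, Inco.cons, t'])
    have hc : Inco.IsChild t' t := ⟨a, rfl⟩
    simp only [hs', ih t' hc]
    exact Order.succ_le_of_lt (IsWellFounded.rank_lt_of_rel hc)
  · rw [IsWellFounded.rank_eq (r := Inco.IsChild) t]
    refine Ordinal.iSup_le fun ⟨t', a, ht'⟩ => ?_
    have hc : Inco.IsChild t' t := ⟨a, ht'⟩
    rw [← ih t' hc]
    refine Order.succ_le_of_lt (IsWellFounded.rank_lt_of_rel ⟨φ a, ?_⟩)
    simp [Inco.cons, ht']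

/-- The singleton node `x`. -/
def Inco.single {A : Type u} [Preorder A] (x : A) : Inco A := ⟨[x], by simp, by simp⟩

theorem Inco.rank_append_le {A : Type u} [Preorder A] [WellQuasiOrderedLE A] (s : Inco A)
    (r : List A) (t : Inco A) (h : t.1 = s.1 ++ r) :
    IsWellFounded.rank Inco.IsChild t ≤ IsWellFounded.rank Inco.IsChild s := by
  induction r using List.reverseRecOn generalizing t with
  | nil => rw [show t = s from Subtype.ext (by simpa using h)]
  | append_singleton r y ih =>
    let t' : Inco A := ⟨s.1 ++ r, by simp [s.2.1], t.2.2.sublist (by simp [h])⟩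
    exact (IsWellFounded.rank_lt_of_rel (show Inco.IsChild t t' from ⟨y, by simp [h, t']⟩)).le.trans
      (ih t' rfl)

theorem Inco.rank_lt_of_append {A : Type u} [Preorder A] [WellQuasiOrderedLE A] (s : Inco A)
    (r : List A) (hr : r ≠ []) (t : Inco A) (h : t.1 = s.1 ++ r) :
    IsWellFounded.rank Inco.IsChild t < IsWellFounded.rank Inco.IsChild s := by
  obtain ⟨y, r, rfl⟩ := List.exists_cons_of_ne_nil hr
  let s' : Inco A := ⟨s.1 ++ [y], by simp, t.2.2.sublist (by simp [h])⟩
  exact (Inco.rank_append_le s' r t (by simp [h, s'])).trans_lt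
    (IsWellFounded.rank_lt_of_rel ⟨y, rfl⟩)

theorem width_le_of_incomp_map {A B : Type u} [Preorder A] [Preorder B] [WellQuasiOrderedLE A]
    [WellQuasiOrderedLE B] (f : A → B) (hf : ∀ x y, Incomp x y → Incomp (f x) (f y)) :
    width A ≤ width B := by
  let F : Inco A → Inco B := fun t =>
    ⟨t.1.map f, by simpa using t.2.1, List.pairwise_map.2 (t.2.2.imp fun {a a'} h => hf a a' h)⟩
  have hF : ∀ t, IsWellFounded.rank Inco.IsChild t ≤ IsWellFounded.rank Inco.IsChild (F t) := by
    intro t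
    induction t using IsWellFounded.induction (Inco.IsChild (A := A)) with
    | _ t ih =>
    rw [IsWellFounded.rank_eq]
    refine Ordinal.iSup_le fun ⟨t', a, ht'⟩ => Order.succ_le_of_lt ?_
    refine (ih t' ⟨a, ht'⟩).trans_lt (IsWellFounded.rank_lt_of_rel ⟨f a, ?_⟩)
    simp [F, ht']
  exact Ordinal.iSup_le fun t => (Order.succ_le_succ (hF t)).trans
    (Ordinal.le_iSup (fun s : Inco B => Order.succ (IsWellFounded.rank Inco.IsChild s)) (F t))

theorem width_congr {A B : Type u} [Preorder A] [Preorder B] [WellQuasiOrderedLE A]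
    [WellQuasiOrderedLE B] (f : A ≃o B) : width A = width B :=
  le_antisymm
    (width_le_of_incomp_map f fun _ _ h => by simpa [Incomp] using h)
    (width_le_of_incomp_map f.symm fun _ _ h => by simpa [Incomp] using h)

/-- The elements of `S` that are incomparable to `x`. -/
def residual {A : Type u} [Preorder A] (S : Set A) (x : A) : Set A := {y | y ∈ S ∧ Incomp x y}

theorem residual_subset {A : Type u} [Preorder A] (S : Set A) (x : A) : residual S x ⊆ S := fun _ h => h.1

variable {A : Type u} [Preorder A] [WellQuasiOrderedLE A]

theorem rank_single {S : Set A} (x : S) :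
    IsWellFounded.rank Inco.IsChild (Inco.single x) = width (residual S x) := by
  let φ : residual S (x : A) → S := fun a => ⟨a, a.2.1⟩
  have hφ : ∀ a a', Incomp (φ a) (φ a') ↔ Incomp a a' := fun _ _ => Iff.rfl
  have hb : ∀ a, Incomp x (φ a) := fun a => a.2.2
  have hrange : ∀ y, Incomp x y → ∃ a, φ a = y := fun y hy => ⟨⟨y, y.2, hy⟩, rfl⟩
  apply le_antisymm
  · rw [IsWellFounded.rank_eq]
    refine Ordinal.iSup_le fun ⟨s, y, hs⟩ => ?_
    have hp := s.2.2
    rw [hs, Inco.single, List.pairwise_append] at hp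
    obtain ⟨a, rfl⟩ := hrange y (hp.2.2 x (by simp) y (by simp))
    have hs' : s = Inco.cons φ x hφ hb (Inco.single a) :=
      Subtype.ext (by simp [hs, Inco.cons, Inco.single])
    simp only [hs', Inco.rank_cons φ x hφ hb hrange]
    exact Ordinal.le_iSup
      (fun s : Inco (residual S (x : A)) => Order.succ (IsWellFounded.rank Inco.IsChild s)) _
  · refine Ordinal.iSup_le fun t => ?_
    rw [← Inco.rank_cons φ x hφ hb hrange]
    refine Order.succ_le_of_lt (Inco.rank_lt_of_append (Inco.single x) (t.1.map φ) ?_ _ rfl)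
    simpa using t.2.1

theorem width_residual_lt {S : Set A} {x : A} (hx : x ∈ S) : width (residual S x) < width S := by
  rw [← Order.succ_le_iff, ← rank_single ⟨x, hx⟩]
  exact Ordinal.le_iSup (fun s : Inco S => Order.succ (IsWellFounded.rank Inco.IsChild s)) _

theorem width_le_of_forall {S : Set A} {β : Ordinal.{u}}
    (h : ∀ x ∈ S, width (residual S x) < β) : width S ≤ β := by
  refine Ordinal.iSup_le fun s => Order.succ_le_of_lt ?_
  obtain ⟨x, r, hr⟩ := List.exists_cons_of_ne_nil s.2.1
  refine (Inco.rank_append_le (Inco.single x) r s (by simp [hr, Inco.single])).trans_lt ?_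
  rw [rank_single]
  exact h x x.2

theorem exists_of_lt_width {S : Set A} {β : Ordinal.{u}} (h : β < width S) :
    ∃ x ∈ S, β ≤ width (residual S x) := by
  by_contra! hcon
  exact (width_le_of_forall hcon).not_gt h

@[simp]
theorem width_empty : width (∅ : Set A) = 0 :=
  nonpos_iff_eq_zero.1 (width_le_of_forall (by simp))

theorem width_le_of_map {B : Type u} [Preorder B] [WellQuasiOrderedLE B] {S : Set A} {T : Set B}
    (f : A → B) (hf : ∀ x ∈ S, f x ∈ T)
    (hinc : ∀ x ∈ S, ∀ y ∈ S, Incomp x y → Incomp (f x) (f y)) : width S ≤ width T := by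
  induction hw : width S using WellFoundedLT.induction generalizing S T with
  | _ o ih =>
  subst hw
  refine width_le_of_forall fun x hx => ?_
  refine lt_of_le_of_lt (ih _ (width_residual_lt hx) (T := residual T (f x)) ?_ ?_ rfl)
    (width_residual_lt (hf x hx))
  · exact fun y hy => ⟨hf y hy.1, hinc x hx y hy.1 hy.2⟩
  · exact fun y hy z hz => hinc y hy.1 z hz.1

theorem width_mono {S T : Set A} (h : S ⊆ T) : width S ≤ width T :=
  width_le_of_map id h fun _ _ _ _ => id

/-- A move in `T j` strictly lowers the `j`-th width and raises no other, and natural sums are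
strictly monotone in each term. -/
theorem width_le_natSum {ι : Type w} (s : Finset ι) (T : ι → Set A) {S : Set A}
    (h : ∀ x ∈ S, ∃ i ∈ s, x ∈ T i) : width S ≤ natSum s fun i => width (T i) := by
  induction hw : width S using WellFoundedLT.induction generalizing S T with
  | _ o ih =>
  subst hw
  refine width_le_of_forall fun x hx => ?_
  obtain ⟨j, hj, hxj⟩ := h x hx
  refine (ih _ (width_residual_lt hx) (fun i => residual (T i) x) ?_ rfl).trans_lt
    (natSum_lt_natSum (fun i _ => width_mono (residual_subset _ _)) hj (width_residual_lt hxj))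
  intro y hy
  obtain ⟨i, hi, hyi⟩ := h y hy.1
  exact ⟨i, hi, hyi, hy.2⟩

/-- If every finite subset of `T₁` leaves a part of `T₂` of width at least `δ`, then a play in
`T₁` can be followed by one in `T₂`. -/
theorem add_width_le {T₁ T₂ : Set A} {δ : Ordinal.{u}}
    (h : ∀ Y : Finset A, ↑Y ⊆ T₁ → δ ≤ width ({y | y ∈ T₂ ∧ ∀ z ∈ Y, Incomp z y} : Set A)) :
    δ + width T₁ ≤ width (T₁ ∪ T₂ : Set A) := by
  classical
  induction hw : width T₁ using WellFoundedLT.induction generalizing T₁ T₂ with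
  | _ o ih =>
  subst hw
  refine le_of_forall_lt fun c hc => ?_
  -- Below `δ`, the part `T₂` alone suffices (`Y = ∅`). From `δ` on, a move `x` in `T₁` is made, and
  -- the hypothesis survives with `x` added to every `Y`.
  rcases lt_or_ge c δ with hcδ | hcδ
  · refine hcδ.trans_le ((h ∅ (by simp)).trans (width_mono ?_))
    exact fun y hy => Or.inr hy.1
  · obtain ⟨c, rfl⟩ := exists_add_of_le hcδ
    obtain ⟨x, hx, hcx⟩ := exists_of_lt_width ((add_lt_add_iff_left δ).1 hc)
    calc δ + c ≤ δ + width (residual T₁ x) := by gcongr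
      _ ≤ width (residual T₁ x ∪ residual T₂ x : Set A) := by
        refine ih _ (width_residual_lt hx) (fun Y hY => ?_) rfl
        refine (h (insert x Y) ?_).trans (width_mono ?_)
        · rw [Finset.coe_insert]
          exact Set.insert_subset hx (hY.trans (residual_subset _ _))
        · rintro y ⟨hy, hinc⟩
          exact ⟨⟨hy, hinc x (by simp)⟩, fun z hz => hinc z (by simp [hz])⟩
      _ ≤ width (residual (T₁ ∪ T₂) x) := width_mono (by
        rintro y (hy | hy)
        · exact ⟨Or.inl hy.1, hy.2⟩
        · exact ⟨Or.inr hy.1, hy.2⟩)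
      _ < width (T₁ ∪ T₂ : Set A) := width_residual_lt (Or.inl hx)

end

section

/-! ### Boxes of ordinals -/

variable {n : ℕ}

/-- The product of the intervals `[p i, p i + q i)`. -/
def box (p q : Fin n → Ordinal.{u}) : Set (Fin n → Ordinal.{u}) :=
  {x | ∀ i, p i ≤ x i ∧ x i < p i + q i}

theorem mem_box_zero {q x : Fin n → Ordinal.{u}} : x ∈ box 0 q ↔ ∀ i, x i < q i := by
  simp [box]

theorem incomp_iff {x y : Fin n → Ordinal.{u}} :
    Incomp x y ↔ (∃ i, y i < x i) ∧ ∃ i, x i < y i := by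
  simp [Incomp, Pi.le_def]

theorem incomp_add_left {p x y : Fin n → Ordinal.{u}} :
    Incomp (fun i => p i + x i) (fun i => p i + y i) ↔ Incomp x y := by
  simp [incomp_iff]

theorem width_le_of_shift (p : Fin n → Ordinal.{u}) {S T : Set (Fin n → Ordinal.{u})}
    (h : ∀ x ∈ S, (fun i => p i + x i) ∈ T) : width S ≤ width T :=
  width_le_of_map (fun x i => p i + x i) h fun _ _ _ _ => incomp_add_left.2

theorem width_box (p q : Fin n → Ordinal.{u}) : width (box p q) = width (box 0 q) := by
  apply le_antisymm
  · refine width_le_of_map (fun x i => x i - p i) (fun x hx => mem_box_zero.2 fun i => ?_) ?_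
    · rw [Ordinal.sub_lt_of_le (hx i).1]
      exact (hx i).2
    · intro x hx y hy h
      refine incomp_add_left (p := p).1 ?_
      simpa only [Ordinal.add_sub_cancel_of_le (hx _).1, Ordinal.add_sub_cancel_of_le (hy _).1]
        using h
  · refine width_le_of_shift p fun x hx i => ?_
    have := mem_box_zero.1 hx i
    exact ⟨le_self_add, (add_lt_add_iff_left _).2 this⟩

theorem box_zero_mono {q q' : Fin n → Ordinal.{u}} (h : q ≤ q') : box 0 q ⊆ box 0 q' :=
  fun _ hx => mem_box_zero.2 fun i => (mem_box_zero.1 hx i).trans_le (h i)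

/-- For `e ≠ 0` the power `ω ^ e` is closed under successor, so finitely many moves in such an
interval can be overtaken inside it. -/
theorem sup_succ_lt_opow {ι : Type v} {Y : Finset ι} {f : ι → Ordinal.{u}} {e : Ordinal.{u}}
    (he : e ≠ 0) (h : ∀ z ∈ Y, f z < ω ^ e) : (Y.sup fun z => f z + 1) < ω ^ e := by
  rw [Finset.sup_lt_iff (by simpa using opow_pos e omega0_pos)]
  intro z hz
  exact isPrincipal_add_omega0_opow e (h z hz) (one_lt_opow.2 ⟨one_lt_omega0, he⟩)

theorem width_pos {A : Type u} [Preorder A] [WellQuasiOrderedLE A] {S : Set A} {x : A}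
    (hx : x ∈ S) : 0 < width S :=
  zero_le.trans_lt (width_residual_lt hx)

theorem mul_natCast_succ (a : Ordinal.{u}) (m : ℕ) :
    a * ((m + 1 : ℕ) : Ordinal.{u}) = a + a * m := by
  rw [add_comm m 1, Nat.cast_add, Nat.cast_one, mul_add, mul_one]

/-- If the part of an indecomposable box that lies under `c` in coordinate `i` has width at least
`δ`, then copies of it can be stacked in that coordinate, while another coordinate is unbounded. -/
theorem mul_natCast_le_width_box {e : Fin n → Ordinal.{u}} {i k : Fin n} (hik : k ≠ i)
    (hk : e k ≠ 0) {c : Ordinal.{u}} (hc : c < ω ^ e i) {δ : Ordinal.{u + 1}}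
    (hδ : δ ≤ width ({y | y ∈ box 0 (fun j => ω ^ e j) ∧ y i < c} : Set (Fin n → Ordinal.{u})))
    (m : ℕ) :
    δ * m ≤ width ({y | y ∈ box 0 (fun j => ω ^ e j) ∧ y i < c * m} :
      Set (Fin n → Ordinal.{u})) := by
  classical
  induction m with
  | zero => simp
  | succ m ih =>
    set X := box 0 (fun j => ω ^ e j)
    -- The upper layers are played first. The bottom layer, pushed beyond those moves in coordinate
    -- `k`, is then incomparable to them: smaller at `i`, larger at `k`.
    set T₁ : Set (Fin n → Ordinal.{u}) := {y | y ∈ X ∧ c ≤ y i ∧ y i < c + c * m}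
    set T₂ : Set (Fin n → Ordinal.{u}) := {y | y ∈ X ∧ y i < c}
    have h₁ : δ * m ≤ width T₁ := by
      refine ih.trans (width_le_of_shift (Function.update 0 i c) ?_)
      rintro y ⟨hy, hyi⟩
      rw [mem_box_zero] at hy
      refine ⟨mem_box_zero.2 fun j => ?_, ?_, ?_⟩
      · rcases eq_or_ne j i with rfl | hj
        · simpa using isPrincipal_add_omega0_opow _ hc (hy j)
        · simpa [hj] using hy j
      · simp
      · simpa using hyi
    have h₂ : ∀ Y : Finset (Fin n → Ordinal.{u}), ↑Y ⊆ T₁ →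
        δ ≤ width ({y | y ∈ T₂ ∧ ∀ z ∈ Y, Incomp z y} : Set (Fin n → Ordinal.{u})) := by
      intro Y hY
      have ht := sup_succ_lt_opow (Y := Y) (f := fun z => z k) hk
        fun z hz => mem_box_zero.1 (hY hz).1 k
      refine hδ.trans (width_le_of_shift (Function.update 0 k (Y.sup fun z => z k + 1)) ?_)
      rintro y ⟨hy, hyi⟩
      rw [mem_box_zero] at hy
      refine ⟨⟨mem_box_zero.2 fun j => ?_, ?_⟩, fun z hz => incomp_iff.2 ⟨⟨i, ?_⟩, ⟨k, ?_⟩⟩⟩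
      · rcases eq_or_ne j k with rfl | hj
        · simpa using isPrincipal_add_omega0_opow _ ht (hy j)
        · simpa [hj] using hy j
      · simpa [hik.symm] using hyi
      · simpa [hik.symm] using hyi.trans_le (hY hz).2.1
      · have h1 : z k + 1 ≤ Y.sup fun z => z k + 1 := Finset.le_sup (f := fun z => z k + 1) hz
        simpa using ((lt_add_one (z k)).trans_le h1).trans_le le_self_add
    rw [mul_natCast_succ, mul_natCast_succ]
    refine (add_le_add_right h₁ δ).trans ((add_width_le h₂).trans (width_mono ?_))
    rintro y (hy | hy)
    · exact ⟨hy.1, hy.2.2⟩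
    · exact ⟨hy.1, hy.2.trans_le le_self_add⟩

/-- Were the width strictly above its leading power `ω ^ g`, some move would leave at least `ω ^ g`.
This remainder is a finite union of parts bounded in one coordinate; one of them has width at least
`ω ^ g`, and stacking copies of it yields `ω ^ (g + 1)`. -/
theorem exists_width_box_eq_opow (e : Fin n → Ordinal.{u}) :
    ∃ g : Ordinal.{u + 1}, width (box 0 fun i => ω ^ e i) = ω ^ g := by
  set X := box 0 fun i => ω ^ e i with hX
  have hpos : 0 < width X :=
    width_pos (x := 0) (mem_box_zero.2 fun i => opow_pos (e i) omega0_pos)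
  set g := log ω (width X)
  refine ⟨g, le_antisymm ?_ (opow_log_le_self ω hpos.ne')⟩
  by_contra! hlt
  obtain ⟨x, hx, hxg⟩ := exists_of_lt_width hlt
  let B : Fin n → Set (Fin n → Ordinal.{u}) := fun i =>
    {y | (y ∈ X ∧ y i < x i) ∧ ∃ k, k ≠ i ∧ x k < y k}
  have hcov : ∀ y ∈ residual X x, ∃ i ∈ Finset.univ, y ∈ B i := by
    rintro y ⟨hy, hinc⟩
    obtain ⟨⟨i, hi⟩, ⟨k, hk⟩⟩ := incomp_iff.1 hinc
    exact ⟨i, Finset.mem_univ _, ⟨hy, hi⟩, k, fun h => (h ▸ hk).not_gt hi, hk⟩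
  obtain ⟨i, hi⟩ : ∃ i, ω ^ g ≤ width (B i) := by
    by_contra! hcon
    exact ((width_le_natSum _ B hcov).trans_lt (natSum_lt_opow fun i _ => hcon i)).not_ge hxg
  -- A point of `B i` exhibits a coordinate `k ≠ i` with a nonzero entry, hence with `e k ≠ 0`, as
  -- stacking requires.
  obtain ⟨y, hy⟩ : (B i).Nonempty := by
    rw [Set.nonempty_iff_ne_empty]
    intro h0
    rw [h0, width_empty] at hi
    exact (opow_pos g omega0_pos).not_ge hi
  obtain ⟨k, hki, hk⟩ := hy.2
  have hek : e k ≠ 0 := by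
    intro h0
    have := mem_box_zero.1 hy.1.1 k
    rw [h0, opow_zero, Order.lt_one_iff] at this
    simp [this] at hk
  have hxi : x i < ω ^ e i := mem_box_zero.1 hx i
  have hmul : ∀ m : ℕ, ω ^ g * m ≤ width X := fun m =>
    (mul_natCast_le_width_box hki hek hxi (hi.trans (width_mono fun _ h => h.1)) m).trans
      (width_mono fun _ h => h.1)
  have h1 : ω ^ Order.succ g ≤ width X := by
    rw [opow_succ]
    refine (mul_le_iff_of_isSuccLimit isSuccLimit_omega0).2 fun b hb => ?_
    obtain ⟨m, rfl⟩ := lt_omega0.1 hb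
    exact hmul m
  exact h1.not_gt (lt_opow_succ_log_self one_lt_omega0 _)

end

section

/-! ### Slices -/

variable {n : ℕ}

/-- The intervals `[p j, p j + ω ^ e j)`, in order and of decreasing lengths, partition `α`. -/
structure IsSlicing (α : Ordinal.{u}) {l : ℕ} (e p : Fin l → Ordinal.{u}) : Prop where
  antitone : Antitone e
  separated : ∀ ⦃j k⦄, j < k → p j + ω ^ e j ≤ p k
  eq_zero : ∀ j : Fin l, (j : ℕ) = 0 → p j = 0
  lt_iff : ∀ x, x < α ↔ ∃ j, p j ≤ x ∧ x < p j + ω ^ e j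

/-- The block of index `s` of a sliced product. -/
def block {l : Fin n → ℕ} (e p : ∀ i, Fin (l i) → Ordinal.{u}) (s : ∀ i, Fin (l i)) :
    Set (Fin n → Ordinal.{u}) :=
  box (fun i => p i (s i)) fun i => ω ^ e i (s i)

variable {α : Fin n → Ordinal.{u}} {l : Fin n → ℕ} {e p : ∀ i, Fin (l i) → Ordinal.{u}}

theorem width_block (s : ∀ i, Fin (l i)) :
    width (block e p s) = width (box 0 fun i => ω ^ e i (s i)) :=
  width_box _ _

theorem width_block_anti (h : ∀ i, IsSlicing (α i) (e i) (p i)) {s t : ∀ i, Fin (l i)}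
    (hst : s ≤ t) : width (block e p t) ≤ width (block e p s) := by
  rw [width_block, width_block]
  exact width_mono (box_zero_mono fun i => opow_le_opow_right omega0_pos ((h i).antitone (hst i)))

theorem lt_of_mem_block (h : ∀ i, IsSlicing (α i) (e i) (p i)) {s t : ∀ i, Fin (l i)}
    {x y : Fin n → Ordinal.{u}} (hx : x ∈ block e p s) (hy : y ∈ block e p t) {i : Fin n}
    (hi : s i < t i) : x i < y i :=
  (hx i).2.trans_le (((h i).separated hi).trans (hy i).1)

/-- Any finite subset of the other blocks leaves a copy of the block `s`, provided that no other
block lies below it and that all blocks are grounded. -/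
theorem width_block_le_residual (h : ∀ i, IsSlicing (α i) (e i) (p i))
    (he : ∀ i (j : Fin (l i)), (j : ℕ) = 0 → e i j ≠ 0) {T : Finset (∀ i, Fin (l i))} (hT : T ⊆ grounded l)
    {s : ∀ i, Fin (l i)} (hs : ∀ t ∈ T, ¬ t ≤ s) (Y : Finset (Fin n → Ordinal.{u}))
    (hY : ∀ z ∈ Y, ∃ t ∈ T, z ∈ block e p t) :
    width (block e p s) ≤
      width ({y | y ∈ block e p s ∧ ∀ z ∈ Y, Incomp z y} : Set (Fin n → Ordinal.{u})) := by
  classical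
  -- In the coordinates where `s` vanishes, the copy of the block starts beyond all entries of `Y`
  -- lying in that first interval.
  let t : Fin n → Ordinal.{u} := fun i =>
    if (s i : ℕ) = 0 then (Y.filter fun z => z i < ω ^ e i (s i)).sup fun z => z i + 1 else 0
  have ht : ∀ i, t i < ω ^ e i (s i) := by
    intro i
    simp only [t]
    split_ifs with h0
    · exact sup_succ_lt_opow (he i _ h0) fun z hz => (Finset.mem_filter.1 hz).2
    · exact opow_pos _ omega0_pos
  rw [width_block]
  refine width_le_of_shift (fun i => p i (s i) + t i) fun y hy => ?_
  rw [mem_box_zero] at hy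
  have hmem : (fun i => p i (s i) + t i + y i) ∈ block e p s := by
    intro i
    simp only [add_assoc]
    exact ⟨le_self_add, (add_lt_add_iff_left _).2
      (isPrincipal_add_omega0_opow _ (ht i) (hy i))⟩
  refine ⟨hmem, fun z hz => ?_⟩
  obtain ⟨r, hr, hzr⟩ := hY z hz
  obtain ⟨j, hj⟩ : ∃ j, s j < r j := by simpa [Pi.le_def] using hs r hr
  refine incomp_iff.2 ⟨⟨j, lt_of_mem_block h hmem hzr hj⟩, ?_⟩
  by_cases hlt : ∃ i, r i < s i
  · obtain ⟨i, hi⟩ := hlt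
    exact ⟨i, lt_of_mem_block h hzr hmem hi⟩
  -- Here `s ≤ r`, so a coordinate `k` grounding `r` also grounds `s`. Both blocks use the first
  -- interval there, and the shift `t k` passes `z k`.
  · push Not at hlt
    obtain ⟨k, hk⟩ := (Finset.mem_filter.1 (hT hr)).2
    have hsk : (s k : ℕ) = 0 := Nat.le_zero.1 (hk ▸ Fin.le_def.1 (hlt k))
    have hrs : r k = s k := Fin.ext (hk.trans hsk.symm)
    refine ⟨k, ?_⟩
    have hzk : z k < p k (r k) + ω ^ e k (r k) := (hzr k).2
    rw [hrs, (h k).eq_zero _ hsk, zero_add] at hzk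
    have h1 : z k + 1 ≤ t k := by
      simp only [t, if_pos hsk]
      have hz' : z ∈ Y.filter fun z => z k < ω ^ e k (s k) := Finset.mem_filter.2 ⟨hz, hzk⟩
      exact Finset.le_sup (f := fun z => z k + 1) hz'
    exact ((lt_add_one _).trans_le h1).trans_le (le_add_self.trans le_self_add)

/-- A block of greatest width is set aside to be played last. Its width is a power of `ω` and goes
on the left of the ordinary sum, where no term of the rest exceeds it, so nothing is absorbed. -/
theorem natSum_le_width_iUnion_block (h : ∀ i, IsSlicing (α i) (e i) (p i))
    (he : ∀ i (j : Fin (l i)), (j : ℕ) = 0 → e i j ≠ 0) {T : Finset (∀ i, Fin (l i))} (hT : T ⊆ grounded l) :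
    natSum T (fun s => width (block e p s)) ≤
      width ({x | ∃ s ∈ T, x ∈ block e p s} : Set (Fin n → Ordinal.{u})) := by
  classical
  induction T using Finset.strongInduction with
  | H T ih =>
  rcases T.eq_empty_or_nonempty with rfl | hne
  · simp
  obtain ⟨s₀, hs₀, hmax⟩ := Finset.exists_max_image T (fun s => width (block e p s)) hne
  -- An index below `s` has a block at least as wide, hence also of greatest width; minimality
  -- therefore leaves no other index of `T` below `s`.
  obtain ⟨s, hs, hmin⟩ := (T.filter fun s => width (block e p s) = width (block e p s₀)).exists_minimal
    ⟨s₀, Finset.mem_filter.2 ⟨hs₀, rfl⟩⟩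
  obtain ⟨hsT, hsw⟩ := Finset.mem_filter.1 hs
  rw [← hsw] at hmax
  have hbelow : ∀ t ∈ T.erase s, ¬ t ≤ s := by
    intro t ht hts
    obtain ⟨hne, htT⟩ := Finset.mem_erase.1 ht
    refine hne (le_antisymm hts (hmin (Finset.mem_filter.2 ⟨htT, ?_⟩) hts))
    rw [← hsw]
    exact le_antisymm (hmax t htT) (width_block_anti h hts)
  have hsub : T.erase s ⊆ grounded l := (Finset.erase_subset _ _).trans hT
  obtain ⟨g, hg⟩ := exists_width_box_eq_opow fun i => e i (s i)
  rw [← width_block (p := p)] at hg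
  calc natSum T (fun s => width (block e p s))
      = natAdd (width (block e p s)) (natSum (T.erase s) fun s => width (block e p s)) := by
        conv_lhs => rw [← Finset.insert_erase hsT]
        rw [natSum_insert (Finset.notMem_erase _ _)]
    _ = width (block e p s) + natSum (T.erase s) fun s => width (block e p s) := by
        rw [hg, opow_add_eq_natAdd]
        refine natSum_lt_opow fun t ht => ?_
        refine (hmax t (Finset.mem_of_mem_erase ht)).trans_lt ?_
        rw [hg]
        exact (opow_lt_opow_iff_right one_lt_omega0).2 (Order.lt_succ g)
    _ ≤ width (block e p s) +
          width ({x | ∃ s' ∈ T.erase s, x ∈ block e p s'} : Set (Fin n → Ordinal.{u})) := by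
        gcongr
        exact ih _ (Finset.erase_ssubset hsT) hsub
    _ ≤ _ := add_width_le fun Y hY => width_block_le_residual h he hsub hbelow Y fun z hz => hY hz
    _ ≤ _ := width_mono (by
        rintro y (⟨t, ht, hy⟩ | hy)
        · exact ⟨t, Finset.mem_of_mem_erase ht, hy⟩
        · exact ⟨s, hsT, hy⟩)

theorem width_iUnion_block (h : ∀ i, IsSlicing (α i) (e i) (p i))
    (he : ∀ i (j : Fin (l i)), (j : ℕ) = 0 → e i j ≠ 0) {T : Finset (∀ i, Fin (l i))} (hT : T ⊆ grounded l) :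
    width ({x | ∃ s ∈ T, x ∈ block e p s} : Set (Fin n → Ordinal.{u})) =
      natSum T fun s => width (block e p s) :=
  le_antisymm (width_le_natSum T _ fun _ hx => hx) (natSum_le_width_iUnion_block h he hT)

/-- The union of the blocks `t + c * (1, ..., 1)` is an ordered sum of these blocks. -/
theorem width_diagonal_le (h : ∀ i, IsSlicing (α i) (e i) (p i)) (t : ∀ i, Fin (l i)) :
    width ({x | ∃ s : ∀ i, Fin (l i), (∃ c : ℕ, ∀ i, (s i : ℕ) = t i + c) ∧ x ∈ block e p s} :
      Set (Fin n → Ordinal.{u})) ≤ width (block e p t) := by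
  refine width_le_of_forall ?_
  rintro x ⟨s, ⟨c, hc⟩, hx⟩
  have hle : width (block e p s) ≤ width (block e p t) :=
    width_block_anti h fun i => Fin.le_def.2 (by rw [hc]; exact Nat.le_add_right _ _)
  refine (width_mono ?_).trans_lt ((width_residual_lt hx).trans_le hle)
  rintro y ⟨⟨r, ⟨d, hd⟩, hy⟩, hinc⟩
  refine ⟨?_, hinc⟩
  -- Points of different blocks of the diagonal are comparable, so only the block containing `x`
  -- survives.
  rcases lt_trichotomy c d with hcd | rfl | hcd
  · exact absurd (fun i => (lt_of_mem_block h hx hy (i := i)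
      (Fin.lt_def.2 (by rw [hc, hd]; omega))).le) hinc.1
  · rwa [show s = r from funext fun i => Fin.ext (by rw [hc, hd])]
  · exact absurd (fun i => (lt_of_mem_block h hy hx (i := i)
      (Fin.lt_def.2 (by rw [hc, hd]; omega))).le) hinc.2

theorem block_subset (h : ∀ i, IsSlicing (α i) (e i) (p i)) (s : ∀ i, Fin (l i)) :
    block e p s ⊆ box 0 α :=
  fun _ hx => mem_box_zero.2 fun i => ((h i).lt_iff _).2 ⟨s i, hx i⟩

theorem width_box_eq_natSum (hn : 0 < n) (h : ∀ i, IsSlicing (α i) (e i) (p i))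
    (he : ∀ i (j : Fin (l i)), (j : ℕ) = 0 → e i j ≠ 0) :
    width (box 0 α) = natSum (grounded l) fun s => width (block e p s) := by
  apply le_antisymm
  · refine (width_le_natSum (grounded l) (fun t => {x | ∃ s : ∀ i, Fin (l i),
      (∃ c : ℕ, ∀ i, (s i : ℕ) = t i + c) ∧ x ∈ block e p s}) fun x hx => ?_).trans
      (natSum_le_natSum fun t _ => width_diagonal_le h t)
    choose s hs using fun i => ((h i).lt_iff _).1 (mem_box_zero.1 hx i)
    have : Nonempty (Fin n) := ⟨⟨0, hn⟩⟩
    -- Subtracting the smallest coordinate from all of them gives the grounded start of the diagonal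
    -- through `s`.
    obtain ⟨k, hk⟩ := Finite.exists_min fun i => (s i : ℕ)
    refine ⟨fun i => ⟨s i - s k, (Nat.sub_le _ _).trans_lt (s i).2⟩,
      Finset.mem_filter.2 ⟨Finset.mem_univ _, k, Nat.sub_self _⟩, s, ⟨s k, fun i => ?_⟩, hs⟩
    exact (Nat.sub_add_cancel (hk i)).symm
  · rw [← width_iUnion_block h he subset_rfl]
    refine width_mono ?_
    rintro x ⟨s, -, hx⟩
    exact block_subset h s hx

/-! ### Slicings from normal forms -/

theorem partialSum_zero {l : ℕ} (e : Fin l → Ordinal.{u}) : partialSum e 0 = 0 := by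
  simp [partialSum]

theorem partialSum_succ {l : ℕ} (e : Fin l → Ordinal.{u}) (j : Fin l) :
    partialSum e (j + 1) = partialSum e j + ω ^ e j := by
  rw [partialSum, partialSum, List.take_add_one, List.sum_append]
  simp

theorem partialSum_mono {l : ℕ} (e : Fin l → Ordinal.{u}) {j k : ℕ} (hjk : j ≤ k) :
    partialSum e j ≤ partialSum e k := by
  obtain ⟨d, rfl⟩ := Nat.exists_eq_add_of_le hjk
  rw [partialSum, partialSum, List.take_add, List.sum_append]
  exact le_self_add

theorem IsPlainNF.isSlicing {o : Ordinal.{u}} {l : ℕ} {e : Fin l → Ordinal.{u}}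
    (h : IsPlainNF o e) : IsSlicing o e fun j => partialSum e j where
  antitone := h.1
  separated j k hjk := by
    rw [← partialSum_succ]
    exact partialSum_mono e hjk
  eq_zero j hj := by rw [hj, partialSum_zero]
  lt_iff x := by
    constructor
    · rw [h.2]
      have key : ∀ m ≤ l, x < partialSum e m →
          ∃ j : Fin l, partialSum e j ≤ x ∧ x < partialSum e j + ω ^ e j := by
        intro m
        induction m with
        | zero => simp [partialSum_zero]
        | succ m ih =>
          intro hm hx
          rcases lt_or_ge x (partialSum e m) with hlt | hge
          · exact ih (by omega) hlt
          · refine ⟨⟨m, hm⟩, hge, ?_⟩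
            rwa [← partialSum_succ]
      exact key l le_rfl
    · rintro ⟨j, -, hj⟩
      rw [← partialSum_succ] at hj
      rw [h.2]
      exact hj.trans_le (partialSum_mono e j.2)

theorem lt_opow_of_partialSum {l : ℕ} (e : Fin l → Ordinal.{u}) {f : Ordinal.{u}}
    (h : ∀ j, e j < f) (m : ℕ) (hm : m ≤ l) : partialSum e m < ω ^ f := by
  induction m with
  | zero => simpa [partialSum_zero] using opow_pos f omega0_pos
  | succ m ih =>
    rw [partialSum_succ e ⟨m, hm⟩]
    exact isPrincipal_add_omega0_opow _ (ih (by omega))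
      ((opow_lt_opow_iff_right one_lt_omega0).2 (h _))

/-- If the leading exponent were `0`, all would be, and the sum would be finite. -/
theorem IsPlainNF.ne_zero {o : Ordinal.{u}} {l : ℕ} {e : Fin l → Ordinal.{u}}
    (h : IsPlainNF o e) (ho : ω ≤ o) (j : Fin l) (hj : (j : ℕ) = 0) : e j ≠ 0 := by
  intro h0
  refine ho.not_gt ?_
  rw [h.2]
  have := lt_opow_of_partialSum e (f := 1) (fun k => ?_) l le_rfl
  · simpa using this
  · rw [Order.lt_one_iff, ← nonpos_iff_eq_zero, ← h0]
    exact h.1 (Fin.le_def.2 (by omega))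

/-! ### Types -/

/-- Inside the single ambient order `Fin n → Ordinal`, products can be shifted, cut and united. -/
theorem width_ordProd (α : Fin n → Ordinal.{u}) : width (OrdProd α) = width (box 0 α) :=
  width_congr
    { toFun := fun x => ⟨fun i => x i, mem_box_zero.2 fun i => (x i).2⟩
      invFun := fun x i => ⟨x.1 i, mem_box_zero.1 x.2 i⟩
      left_inv := fun _ => rfl
      right_inv := fun _ => rfl
      map_rel_iff' := Iff.rfl }

theorem width_slice (h : ∀ i, IsPlainNF (α i) (e i)) (s : ∀ i, Fin (l i)) :
    width (slice α e s) = width (block e (fun i j => partialSum (e i) j) s) :=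
  width_congr
    { toFun := fun x => ⟨fun i => x.1 i, fun i => by
        have := x.2 i
        rwa [partialSum_succ] at this⟩
      invFun := fun x => ⟨fun i => ⟨x.1 i,
        mem_box_zero.1 (block_subset (fun i => (h i).isSlicing) s x.2) i⟩, fun i => by
          rw [partialSum_succ]
          exact x.2 i⟩
      left_inv := fun _ => rfl
      right_inv := fun _ => rfl
      map_rel_iff' := Iff.rfl }

end

section

/-! ### Multiplicities of normal forms -/

theorem multiplicities_list_sum (L : List (Ordinal.{u} × ℕ)) (hL : L.Pairwise fun x y => y.1 ≤ x.1) :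
    multiplicities (L.map fun x => ω ^ x.1 * (x.2 : Ordinal.{u})).sum =
      (L.map fun x => Finsupp.single x.1 x.2).sum := by
  induction L with
  | nil => simp
  | cons x L ih =>
    rw [List.pairwise_cons] at hL
    have hlt : ∀ L' : List (Ordinal.{u} × ℕ), (∀ y ∈ L', y.1 ≤ x.1) →
        (L'.map fun x => ω ^ x.1 * (x.2 : Ordinal.{u})).sum < ω ^ Order.succ x.1 := by
      intro L'
      induction L' with
      | nil => exact fun _ => opow_pos _ omega0_pos
      | cons y L' ih' =>
        intro h
        rw [List.map_cons, List.sum_cons]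
        refine isPrincipal_add_omega0_opow _ ?_ (ih' fun z hz => h z (List.mem_cons_of_mem _ hz))
        exact IsPrincipal.mul_natCast_lt (isPrincipal_add_omega0_opow _)
          ((opow_lt_opow_iff_right one_lt_omega0).2 (Order.lt_succ_iff.2 (h y (by simp)))) _
    rw [List.map_cons, List.sum_cons, multiplicities_opow_mul_add (hlt L hL.1), ih hL.2,
      List.map_cons, List.sum_cons]

theorem IsDevelopedNF.multiplicities_eq {o : Ordinal.{u}} {l : ℕ} {e : Fin l → Ordinal.{u}}
    {a : Fin l → ℕ} (h : IsDevelopedNF o e a) :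
    multiplicities o = ∑ j, Finsupp.single (e j) (a j) := by
  rw [h.2.2, ← List.sum_ofFn]
  have := multiplicities_list_sum (List.ofFn fun j => (e j, a j))
    (List.pairwise_ofFn.2 fun j k hjk => (h.1 hjk).le)
  simpa [List.map_ofFn, Function.comp_def] using this

theorem IsPlainNF.multiplicities_eq {o : Ordinal.{u}} {l : ℕ} {e : Fin l → Ordinal.{u}}
    (h : IsPlainNF o e) : multiplicities o = ∑ j, Finsupp.single (e j) 1 := by
  rw [h.2, ← List.sum_ofFn, partialSum, List.take_of_length_le (by simp)]
  have := multiplicities_list_sum (List.ofFn fun j => (e j, 1))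
    (List.pairwise_ofFn.2 fun j k hjk => h.1 hjk.le)
  simpa [List.map_ofFn, Function.comp_def] using this

theorem IsPlainNF.card_filter_eq {o : Ordinal.{u}} {l : ℕ} {e : Fin l → Ordinal.{u}}
    (h : IsPlainNF o e) (x : Ordinal.{u}) :
    (Finset.univ.filter fun j => e j = x).card = multiplicities o x := by
  classical
  rw [h.multiplicities_eq, Finsupp.finsetSum_apply, Finset.card_filter]
  exact Finset.sum_congr rfl fun j _ => by rw [Finsupp.single_apply]

theorem IsDevelopedNF.multiplicities_apply {o : Ordinal.{u}} {l : ℕ} {e : Fin l → Ordinal.{u}}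
    {a : Fin l → ℕ} (h : IsDevelopedNF o e a) (j : Fin l) : multiplicities o (e j) = a j := by
  classical
  rw [h.multiplicities_eq, Finsupp.finsetSum_apply, Finset.sum_eq_single j]
  · simp
  · intro k _ hk
    exact Finsupp.single_eq_of_ne (h.1.injective.ne hk.symm)
  · simp

theorem IsDevelopedNF.exists_eq {o : Ordinal.{u}} {l : ℕ} {e : Fin l → Ordinal.{u}}
    {a : Fin l → ℕ} (h : IsDevelopedNF o e a) {x : Ordinal.{u}} (hx : multiplicities o x ≠ 0) :
    ∃ j, e j = x := by
  classical
  by_contra! hcon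
  refine hx ?_
  rw [h.multiplicities_eq, Finsupp.finsetSum_apply]
  exact Finset.sum_eq_zero fun j _ => Finsupp.single_eq_of_ne (hcon j).symm

theorem IsPlainNF.multiplicities_ne_zero {o : Ordinal.{u}} {l : ℕ} {e : Fin l → Ordinal.{u}}
    (h : IsPlainNF o e) (j : Fin l) : multiplicities o (e j) ≠ 0 := by
  classical
  rw [← h.card_filter_eq]
  exact (Finset.card_pos.2 ⟨j, by simp⟩).ne'

theorem IsShortNF.multiplicities_eq {o ε σ : Ordinal.{u}} {b : ℕ} (h : IsShortNF o ε b σ) :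
    multiplicities o = .single ε b + multiplicities σ := by
  rw [h.2.2, multiplicities_opow_mul_add
    (h.2.1.trans ((opow_lt_opow_iff_right one_lt_omega0).2 (Order.lt_succ ε)))]

theorem IsShortNF.multiplicities_apply {o ε σ : Ordinal.{u}} {b : ℕ} (h : IsShortNF o ε b σ) :
    multiplicities o ε = b := by
  have : multiplicities σ ε = 0 := by
    by_contra hne
    exact (lt_opow_iff.1 h.2.1 ε (Finsupp.mem_support_iff.2 hne)).false
  simp [h.multiplicities_eq, this]

theorem IsShortNF.le_of_multiplicities_ne_zero {o ε σ : Ordinal.{u}} {b : ℕ}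
    (h : IsShortNF o ε b σ) {x : Ordinal.{u}} (hx : multiplicities o x ≠ 0) : x ≤ ε := by
  by_contra! hlt
  refine hx ?_
  have : multiplicities σ x = 0 := by
    by_contra hne
    exact (lt_opow_iff.1 h.2.1 x (Finsupp.mem_support_iff.2 hne)).not_gt hlt
  rw [h.multiplicities_eq, Finsupp.add_apply, this, Finsupp.single_eq_of_ne hlt.ne']

section Short

variable {o ε σ : Ordinal.{u}} {b l : ℕ} {e : Fin l → Ordinal.{u}}

/-- The exponent `ε` is the largest and occurs `b` times; by monotonicity its occurrences form the
initial segment. -/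
theorem IsShortNF.lt_iff (hs : IsShortNF o ε b σ) (hp : IsPlainNF o e) (j : Fin l) :
    (j : ℕ) < b ↔ e j = ε := by
  classical
  have hcard := hp.card_filter_eq ε
  rw [hs.multiplicities_apply] at hcard
  have hle : ∀ k, e k ≤ ε := fun k => hs.le_of_multiplicities_ne_zero (hp.multiplicities_ne_zero k)
  constructor
  · intro hj
    by_contra hne
    refine hj.not_ge ?_
    rw [← hcard, ← Fin.card_Iio j]
    refine Finset.card_le_card fun k hk => Finset.mem_Iio.2 ?_
    by_contra! hjk
    exact hne (le_antisymm (hle j) ((Finset.mem_filter.1 hk).2.symm.le.trans (hp.1 hjk)))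
  · intro hj
    rw [← hcard, ← Nat.succ_le_iff, Nat.succ_eq_add_one, ← Fin.card_Iic j]
    refine Finset.card_le_card fun k hk => Finset.mem_filter.2 ⟨Finset.mem_univ _, ?_⟩
    exact le_antisymm (hle k) (hj.symm.le.trans (hp.1 (Finset.mem_Iic.1 hk)))

theorem IsShortNF.le_length (hs : IsShortNF o ε b σ) (hp : IsPlainNF o e) : b ≤ l := by
  classical
  rw [← hs.multiplicities_apply, ← hp.card_filter_eq]
  exact (Finset.card_le_univ _).trans (by simp)

theorem IsShortNF.partialSum_eq (hs : IsShortNF o ε b σ) (hp : IsPlainNF o e) :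
    partialSum e b = ω ^ ε * (b : Ordinal.{u}) := by
  have key : ∀ m ≤ b, partialSum e m = ω ^ ε * (m : Ordinal.{u}) := by
    intro m hm
    induction m with
    | zero => simp [partialSum_zero]
    | succ m ih =>
      have := partialSum_succ e ⟨m, hm.trans (hs.le_length hp)⟩
      simp only at this
      rw [this, ih (by omega), (hs.lt_iff hp ⟨m, _⟩).1 hm]
      push_cast
      rw [mul_add_one]
  exact key b le_rfl

end Short

/-! ### Counting grounded indices -/

variable {n : ℕ} {l : Fin n → ℕ}

/-- All choices minus those avoiding `0` everywhere: the source of the differences of products in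
the theorem. -/
theorem card_grounded_filter (F : ∀ i, Finset (Fin (l i))) :
    ((grounded l).filter fun s => ∀ i, s i ∈ F i).card =
      (∏ i, (F i).card) - ∏ i, ((F i).filter fun j : Fin (l i) => (j : ℕ) ≠ 0).card := by
  classical
  rw [← Fintype.card_piFinset, ← Fintype.card_piFinset, ← Finset.card_sdiff_of_subset]
  · congr 1
    ext s
    simp only [grounded, Finset.mem_filter, Finset.mem_univ, true_and, Finset.mem_sdiff,
      Fintype.mem_piFinset]
    constructor
    · rintro ⟨⟨k, hk⟩, hs⟩
      exact ⟨hs, fun h => (h k).2 hk⟩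
    · rintro ⟨hs, h⟩
      refine ⟨?_, hs⟩
      by_contra hcon
      exact h fun i => ⟨hs i, fun h0 => hcon ⟨i, h0⟩⟩
  · exact Fintype.piFinset_subset _ _ fun i => Finset.filter_subset _ _

theorem prod_sub_prod_eq {l' : Fin n → ℕ} (t : ∀ i, Fin (l' i)) (c : Fin n → ℕ) :
    (∏ i, c i) - ∏ i, (if (t i : ℕ) = 0 then c i - 1 else c i) =
      ((∏ i with (t i : ℕ) = 0, c i) - ∏ i with (t i : ℕ) = 0, (c i - 1)) *
        ∏ i with 0 < (t i : ℕ), c i := by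
  rw [Nat.sub_mul, ← Finset.prod_filter_mul_prod_filter_not _ (fun i => (t i : ℕ) = 0) c,
    Finset.prod_ite]
  simp only [Nat.pos_iff_ne_zero]

theorem card_filter_ne_zero {m : ℕ} (F : Finset (Fin m)) {z : Fin m} (hz : (z : ℕ) = 0)
    (hF : z ∈ F) : (F.filter fun j : Fin m => (j : ℕ) ≠ 0).card = F.card - 1 := by
  classical
  rw [← Finset.card_erase_of_mem hF]
  congr 1
  ext j
  rw [Finset.mem_filter, Finset.mem_erase, Ne, Ne, Fin.ext_iff, hz]
  tauto

/-- Terms with the same exponents are collected: `τ` sends a plain index to the developed index of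
its exponent, and the coefficient is the size of the fibre. -/
theorem sum_grounded_developed {M : Type w} [AddCommMonoid M] {α : Fin n → Ordinal.{u}}
    {e : ∀ i, Fin (l i) → Ordinal.{u}} (hplain : ∀ i, IsPlainNF (α i) (e i)) {l' : Fin n → ℕ}
    {e' : ∀ i, Fin (l' i) → Ordinal.{u}} {a : ∀ i, Fin (l' i) → ℕ}
    (hdev : ∀ i, IsDevelopedNF (α i) (e' i) (a i)) (G : (Fin n → Ordinal.{u}) → M) :
    ∑ s ∈ grounded l, G (fun i => e i (s i)) =
      ∑ t ∈ grounded l',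
        (((∏ i with (t i : ℕ) = 0, a i (t i)) - (∏ i with (t i : ℕ) = 0, (a i (t i) - 1))) *
              (∏ i with 0 < (t i : ℕ), a i (t i))) • G (fun i => e' i (t i)) := by
  classical
  choose τ hτ using fun i j => (hdev i).exists_eq ((hplain i).multiplicities_ne_zero j)
  have hcard : ∀ i t, (Finset.univ.filter fun j => τ i j = t).card = a i t := by
    intro i t
    rw [← (hdev i).multiplicities_apply, ← (hplain i).card_filter_eq]
    congr 1
    ext j
    rw [Finset.mem_filter, Finset.mem_filter, ← hτ, (hdev i).1.injective.eq_iff]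
  have hzero : ∀ i (j : Fin (l i)), (j : ℕ) = 0 → (τ i j : ℕ) = 0 := by
    intro i j hj
    have hpos : 0 < l' i := (Nat.zero_le _).trans_lt (τ i j).2
    obtain ⟨k, hk⟩ := Finset.card_pos.1 (((hdev i).2.1 ⟨0, hpos⟩).trans_eq (hcard i _).symm)
    rw [Finset.mem_filter] at hk
    have h1 : e' i (τ i k) ≤ e' i (τ i j) := by
      rw [hτ, hτ]
      exact (hplain i).1 (Fin.le_def.2 (by omega))
    have h2 := Fin.le_def.1 ((hdev i).1.le_iff_ge.1 h1)
    simpa [hk.2] using h2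
  rw [← Finset.sum_fiberwise_of_maps_to (t := grounded l') (g := fun s i => τ i (s i))]
  · refine Finset.sum_congr rfl fun t ht => ?_
    rw [Finset.sum_congr rfl (g := fun _ => G fun i => e' i (t i)), Finset.sum_const]
    · congr 1
      have : ((grounded l).filter fun s => (fun i => τ i (s i)) = t) =
          (grounded l).filter fun s => ∀ i, s i ∈ Finset.univ.filter fun j => τ i j = t i := by
        ext s
        simp [funext_iff]
      rw [this, card_grounded_filter, ← prod_sub_prod_eq]
      congr 1
      · exact Finset.prod_congr rfl fun i _ => hcard i _
      · refine Finset.prod_congr rfl fun i _ => ?_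
        -- The plain index `0` carries the largest exponent, so it lies in the fibre over `0` and in
        -- no other.
        split_ifs with h0
        · obtain ⟨k, hk⟩ := Finset.card_pos.1 (((hdev i).2.1 (t i)).trans_eq (hcard i _).symm)
          have hpos : 0 < l i := (Nat.zero_le _).trans_lt k.2
          rw [card_filter_ne_zero _ (z := ⟨0, hpos⟩) rfl, hcard]
          simpa using Fin.ext ((hzero i ⟨0, hpos⟩ rfl).trans h0.symm)
        · rw [Finset.filter_true_of_mem, hcard]
          intro j hj hj0
          rw [Finset.mem_filter] at hj
          exact h0 (hj.2 ▸ hzero i j hj0)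
    · intro s hs
      rw [← (Finset.mem_filter.1 hs).2]
      simp only [hτ]
  · intro s hs
    obtain ⟨k, hk⟩ := (Finset.mem_filter.1 hs).2
    exact Finset.mem_filter.2 ⟨Finset.mem_univ _, k, hzero k _ hk⟩

/-- The indices that vanish on `I` and are at least `b i` for `i ∉ I`. -/
def tailIndices (l b : Fin n → ℕ) (I : Finset (Fin n)) : Finset (∀ i, Fin (l i)) :=
  Finset.univ.filter fun s => ∀ i, if i ∈ I then (s i : ℕ) = 0 else b i ≤ s i

theorem mem_tailIndices {b : Fin n → ℕ} {I : Finset (Fin n)} {s : ∀ i, Fin (l i)} :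
    s ∈ tailIndices l b I ↔ ∀ i, if i ∈ I then (s i : ℕ) = 0 else b i ≤ s i := by
  simp [tailIndices]

theorem tailIndices_subset (b : Fin n → ℕ) {I : Finset (Fin n)} (hI : I.Nonempty) :
    tailIndices l b I ⊆ grounded l := by
  intro s hs
  obtain ⟨k, hk⟩ := hI
  have := mem_tailIndices.1 hs k
  rw [if_pos hk] at this
  exact Finset.mem_filter.2 ⟨Finset.mem_univ _, k, this⟩

theorem sum_grounded_short {M : Type w} [AddCommMonoid M] {α : Fin n → Ordinal.{u}}
    {e : ∀ i, Fin (l i) → Ordinal.{u}} (hplain : ∀ i, IsPlainNF (α i) (e i))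
    {ε σ : Fin n → Ordinal.{u}} {b : Fin n → ℕ}
    (hshort : ∀ i, IsShortNF (α i) (ε i) (b i) (σ i)) (G : (Fin n → Ordinal.{u}) → M) :
    ∑ s ∈ grounded l, G (fun i => e i (s i)) =
      ∑ I : Finset (Fin n) with I.Nonempty, ((∏ i ∈ I, b i) - ∏ i ∈ I, (b i - 1)) •
        ∑ s ∈ tailIndices l b I, G (fun i => e i (s i)) := by
  classical
  have hl : ∀ i, 0 < l i := fun i => (hshort i).1.trans_le ((hshort i).le_length (hplain i))
  -- The set `I` of a term records the coordinates using a leading exponent; `ρ` resets these to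
  -- `0`, which changes no exponent.
  let supp : (∀ i, Fin (l i)) → Finset (Fin n) := fun s => Finset.univ.filter fun i => (s i : ℕ) < b i
  let ρ : (∀ i, Fin (l i)) → ∀ i, Fin (l i) := fun s i => if (s i : ℕ) < b i then ⟨0, hl i⟩ else s i
  rw [← Finset.sum_fiberwise_of_maps_to (g := supp)
    (t := Finset.univ.filter fun I : Finset (Fin n) => I.Nonempty)]
  · refine Finset.sum_congr rfl fun I _ => ?_
    rw [← Finset.sum_fiberwise_of_maps_to (t := tailIndices l b I) (g := ρ), Finset.smul_sum]
    · refine Finset.sum_congr rfl fun u hu => ?_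
      rw [mem_tailIndices] at hu
      rw [Finset.sum_congr rfl (g := fun _ => G fun i => e i (u i)), Finset.sum_const]
      · congr 1
        let F : ∀ i, Finset (Fin (l i)) := fun i =>
          if i ∈ I then Finset.univ.filter fun j => (j : ℕ) < b i else {u i}
        have hset : (((grounded l).filter fun s => supp s = I).filter fun s => ρ s = u) =
            (grounded l).filter fun s => ∀ i, s i ∈ F i := by
          rw [Finset.filter_filter]
          refine Finset.filter_congr fun s _ => ?_
          simp only [Finset.ext_iff, supp, ρ, funext_iff, F, Finset.mem_filter, Finset.mem_univ,
            true_and]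
          rw [← forall_and]
          refine forall_congr' fun i => ?_
          have hui := hu i
          have hbi := (hshort i).1
          by_cases hi : i ∈ I
          · rw [if_pos hi] at hui
            by_cases hsi : (s i : ℕ) < b i
            · simp [hi, hsi, Fin.ext_iff, hui]
            · simp [hi, hsi]
          · rw [if_neg hi] at hui
            by_cases hsi : (s i : ℕ) < b i
            · simp only [hi, hsi, if_false, Finset.mem_singleton]
              simp only [true_iff, false_and, false_iff]
              rintro h
              rw [h] at hsi
              omega
            · simp [hi, hsi]
        have hF : ∀ i, (F i).card = if i ∈ I then b i else 1 := by
          intro i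
          simp only [F]
          split_ifs
          · rw [Fin.card_filter_val_lt, min_eq_right ((hshort i).le_length (hplain i))]
          · simp
        rw [hset, card_grounded_filter]
        congr 1
        · simp [hF]
        · have : ∀ i, ((F i).filter fun j : Fin (l i) => (j : ℕ) ≠ 0).card = if i ∈ I then b i - 1 else 1 := by
            intro i
            have hui := hu i
            have hbi := (hshort i).1
            by_cases hi : i ∈ I
            · rw [card_filter_ne_zero _ (z := ⟨0, hl i⟩) rfl, hF, if_pos hi, if_pos hi]
              simpa [F, hi] using hbi
            · rw [if_neg hi] at hui
              rw [Finset.filter_true_of_mem, hF, if_neg hi, if_neg hi]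
              intro j hj
              simp only [F, hi, if_false, Finset.mem_singleton] at hj
              rw [hj]
              omega
          simp [this]
      · intro s hs
        rw [← (Finset.mem_filter.1 hs).2]
        congr 1
        funext i
        simp only [ρ]
        split_ifs with h
        · rw [((hshort i).lt_iff (hplain i) _).1 h,
            ((hshort i).lt_iff (hplain i) ⟨0, hl i⟩).1 (hshort i).1]
        · rfl
    · intro s hs
      refine mem_tailIndices.2 fun i => ?_
      rw [← (Finset.mem_filter.1 hs).2]
      simp only [supp, ρ, Finset.mem_filter, Finset.mem_univ, true_and]
      split_ifs with h
      · rfl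
      · exact not_lt.1 h
  · intro s hs
    obtain ⟨k, hk⟩ := (Finset.mem_filter.1 hs).2
    refine Finset.mem_filter.2 ⟨Finset.mem_univ _, k, ?_⟩
    simpa [supp, hk] using (hshort k).1

/-- A copy of `X_I` inside the product: the first interval for `i ∈ I`, the final stretch of length
`σ i` for the others. -/
theorem box_eq_iUnion_block {α : Fin n → Ordinal.{u}}
    {e : ∀ i, Fin (l i) → Ordinal.{u}} (hplain : ∀ i, IsPlainNF (α i) (e i))
    {ε σ : Fin n → Ordinal.{u}} {b : Fin n → ℕ}
    (hshort : ∀ i, IsShortNF (α i) (ε i) (b i) (σ i)) (I : Finset (Fin n)) :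
    box (fun i => if i ∈ I then 0 else ω ^ ε i * (b i : Ordinal.{u}))
        (fun i => if i ∈ I then ω ^ ε i else σ i) =
      {x | ∃ s ∈ tailIndices l b I, x ∈ block e (fun i j => partialSum (e i) j) s} := by
  have hl : ∀ i, 0 < l i := fun i => (hshort i).1.trans_le ((hshort i).le_length (hplain i))
  have he : ∀ i (j : Fin (l i)), (j : ℕ) = 0 → e i j = ε i := fun i j hj =>
    ((hshort i).lt_iff (hplain i) _).1 (hj ▸ (hshort i).1)
  ext x
  constructor
  · intro hx
    have : ∀ i, ∃ j : Fin (l i), (if i ∈ I then (j : ℕ) = 0 else b i ≤ j) ∧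
        partialSum (e i) j ≤ x i ∧ x i < partialSum (e i) j + ω ^ e i j := by
      intro i
      have hxi := hx i
      split_ifs with hi
      · refine ⟨⟨0, hl i⟩, rfl, ?_⟩
        simpa [hi, partialSum_zero, he i ⟨0, hl i⟩ rfl] using hxi
      · simp only [hi, if_false] at hxi
        rw [← (hshort i).2.2] at hxi
        obtain ⟨j, hj⟩ := ((hplain i).isSlicing.lt_iff _).1 hxi.2
        refine ⟨j, ?_, hj⟩
        by_contra! hlt
        refine hxi.1.not_gt (hj.2.trans_le ?_)
        rw [← partialSum_succ, ← (hshort i).partialSum_eq (hplain i)]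
        exact partialSum_mono _ hlt
    choose s hs using this
    exact ⟨s, mem_tailIndices.2 fun i => (hs i).1, fun i => (hs i).2⟩
  · rintro ⟨s, hs, hx⟩ i
    have hxi : partialSum (e i) (s i) ≤ x i ∧ x i < partialSum (e i) (s i) + ω ^ e i (s i) := hx i
    have hsi := mem_tailIndices.1 hs i
    by_cases hi : i ∈ I
    · rw [if_pos hi] at hsi
      rw [hsi, partialSum_zero, he i _ hsi] at hxi
      simpa [hi] using hxi
    · rw [if_neg hi] at hsi
      simp only [hi, if_false]
      refine ⟨?_, ?_⟩
      · rw [← (hshort i).partialSum_eq (hplain i)]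
        exact (partialSum_mono _ hsi).trans hxi.1
      · rw [← (hshort i).2.2]
        exact ((hplain i).isSlicing.lt_iff _).2 ⟨_, hxi⟩

end

end WqoWidth

/-! ### The three formulas -/

theorem mainTheorem6 {n : ℕ} (hn : 0 < n) (α : Fin n → Ordinal.{u}) (hα : ∀ i, ω ≤ α i)
    (l : Fin n → ℕ) (e : ∀ i, Fin (l i) → Ordinal.{u})
    (hplain : ∀ i, WqoWidth.IsPlainNF (α i) (e i))
    (l' : Fin n → ℕ) (e' : ∀ i, Fin (l' i) → Ordinal.{u}) (a : ∀ i, Fin (l' i) → ℕ)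
    (hdev : ∀ i, WqoWidth.IsDevelopedNF (α i) (e' i) (a i))
    (ε : Fin n → Ordinal.{u}) (b : Fin n → ℕ) (σ : Fin n → Ordinal.{u})
    (hshort : ∀ i, WqoWidth.IsShortNF (α i) (ε i) (b i) (σ i)) :
    WqoWidth.width (WqoWidth.OrdProd α) =
        WqoWidth.natSum (WqoWidth.grounded l) (fun s => WqoWidth.width (WqoWidth.slice α e s)) ∧
      WqoWidth.width (WqoWidth.OrdProd α) =
        WqoWidth.natSum (WqoWidth.grounded l') (fun t =>
          WqoWidth.natMul (WqoWidth.width (WqoWidth.OrdProd fun i => ω ^ e' i (t i)))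
            ((((∏ i with (t i : ℕ) = 0, a i (t i)) - (∏ i with (t i : ℕ) = 0, (a i (t i) - 1))) *
              (∏ i with 0 < (t i : ℕ), a i (t i)) : ℕ) : Ordinal.{u + 1})) ∧
      WqoWidth.width (WqoWidth.OrdProd α) =
        WqoWidth.natSum {I : Finset (Fin n) | I.Nonempty} (fun I =>
          WqoWidth.natMul
            (WqoWidth.width (WqoWidth.OrdProd fun i => if i ∈ I then ω ^ ε i else σ i))
            (((∏ i ∈ I, b i) - (∏ i ∈ I, (b i - 1)) : ℕ) : Ordinal.{u + 1})) := by
  open WqoWidth in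
  have hS := fun i => (hplain i).isSlicing
  have he := fun i => (hplain i).ne_zero (hα i)
  have hmain : width (OrdProd α) = natSum (grounded l) fun s => width (slice α e s) := by
    simp only [width_ordProd, width_slice hplain, width_box_eq_natSum hn hS he]
  have hmult : multiplicities (width (OrdProd α)) = ∑ s ∈ grounded l,
      multiplicities (width (box 0 fun i => ω ^ e i (s i))) := by
    simp only [hmain, multiplicities_natSum, width_slice hplain, width_block]
  -- On multiplicities, natural sums become sums and natural products with integers become scalar
  -- multiples, so only a regrouping of finite sums remains.
  refine ⟨hmain, multiplicities_injective ?_, multiplicities_injective ?_⟩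
  · rw [hmult]
    simp only [multiplicities_natSum, multiplicities_natMul_natCast, width_ordProd]
    exact sum_grounded_developed hplain hdev fun x =>
      multiplicities (width (box 0 fun i => ω ^ x i))
  · simp only [hmult, multiplicities_natSum, multiplicities_natMul_natCast]
    rw [sum_grounded_short hplain hshort fun x => multiplicities (width (box 0 fun i => ω ^ x i))]
    refine Finset.sum_congr rfl fun I hI => ?_
    rw [width_ordProd, ← width_box, box_eq_iUnion_block hplain hshort,
      width_iUnion_block hS he (tailIndices_subset b (Finset.mem_filter.1 hI).2)]
    simp only [multiplicities_natSum, width_block]
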